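/- Let $\mathbb N=\{0,1,2,\dots\}$. A numerical semigroup is a submonoid $\Gamma$ of $(\mathbb N,+)$ with finite complement. Its embedding dimension $\mathrm e(\Gamma)$ is the number of elements $r_0,\dots,r_h$ of its unique minimal generating set, and its multiplicity $\mathrm m(\Gamma)$ is its smallest positive element. A presentation of $\Gamma$ is a set of pairs that generates the congruence $\{(a,b) : \varphi(a)=\varphi(b)\}$ on $\mathbb N^{\mathrm e(\Gamma)}$, where $\varphi(a_0,\dots,a_h)=a_0r_0+\cdots+a_hr_h$; a presentation is minimal if it is minimal with respect to inclusion. $\Gamma$ is a complete intersection if it has a minimal presentation of cardinality $\mathrm e(\Gamma)-1$. (1) If $\Gamma$ is a complete intersection numerical semigroup, then $$\mathrm m(\Gamma)\ge 2^{\mathrm e(\Gamma)-1}.$$ (2) The bound is attained. For $n\ge 1$ put $$\Gamma^{(n)}=\langle 2^n,\,2^n+1,\,2^n+2,\,2^n+2^2,\dots,2^n+2^{n-1}\rangle,$$ so that $\Gamma^{(1)}=\langle 2,3\rangle$, $\Gamma^{(2)}=\langle 4,5,6\rangle$, $\Gamma^{(3)}=\langle 8,9,10,12\rangle$, and $\Gamma^{(n+1)}=2\Gamma^{(n)}+(2^{n+1}+1)\mathbb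 N$ for all $n\ge 1$. Every $\Gamma^{(n)}$ with $n\ge1$ is a complete intersection numerical semigroup with $\mathrm m(\Gamma^{(n)})=2^n$ and $\mathrm e(\Gamma^{(n)})=n+1$. -/

import Mathlib

/-- A numerical semigroup is a submonoid of `ℕ` with finite complement. -/
def IsNumericalSemigroup (Γ : AddSubmonoid ℕ) : Prop :=
  ((Γ : Set ℕ)ᶜ).Finite

/-- The minimal generators of `Γ`: the nonzero elements of `Γ` that are not a sum of two nonzero
elements of `Γ`. By `minimal_closure_eq_iff` below, this is the unique inclusion-minimal
generating set of `Γ`. -/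
def minimalGenerators (Γ : AddSubmonoid ℕ) : Set ℕ :=
  {x | x ∈ Γ ∧ x ≠ 0 ∧ ∀ y ∈ Γ, ∀ z ∈ Γ, x = y + z → y = 0 ∨ z = 0}

theorem closure_minimalGenerators (Γ : AddSubmonoid ℕ) :
    AddSubmonoid.closure (minimalGenerators Γ) = Γ := by
  apply le_antisymm
  · rw [AddSubmonoid.closure_le]
    exact fun x hx => hx.1
  · intro x
    induction x using Nat.strong_induction_on with
    | _ x ih =>
      intro hx
      by_cases h0 : x = 0
      · rw [h0]; exact zero_mem _
      by_cases hm : x ∈ minimalGenerators Γ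
      · exact AddSubmonoid.subset_closure hm
      · simp only [minimalGenerators, Set.mem_ofPred_eq, not_and, not_forall, not_or] at hm
        obtain ⟨y, hy, z, hz, e, hy0, hz0⟩ := hm hx h0
        rw [e]
        exact add_mem (ih y (by omega) hy) (ih z (by omega) hz)

theorem minimalGenerators_subset (Γ : AddSubmonoid ℕ) (A : Set ℕ)
    (hA : AddSubmonoid.closure A = Γ) : minimalGenerators Γ ⊆ A := by
  rintro x ⟨hx, hx0, hirr⟩
  subst hA
  have key : ∀ w, w ∈ AddSubmonoid.closure A → w = x → x ∈ A := by
    intro w hw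
    induction hw using AddSubmonoid.closure_induction with
    | mem a ha => rintro rfl; exact ha
    | zero => intro h; exact absurd h.symm hx0
    | add a b ha hb iha ihb =>
      intro h
      rcases hirr a ha b hb h.symm with h' | h'
      · exact ihb (by omega)
      · exact iha (by omega)
  exact key x hx rfl

theorem minimal_closure_eq_iff (Γ : AddSubmonoid ℕ) (A : Set ℕ) :
    Minimal (fun B : Set ℕ => AddSubmonoid.closure B = Γ) A ↔ A = minimalGenerators Γ := by
  constructor
  · intro h
    have hs := minimalGenerators_subset Γ A h.prop
    exact Set.Subset.antisymm (h.le_of_le (closure_minimalGenerators Γ) hs) hs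
  · rintro rfl
    exact ⟨closure_minimalGenerators Γ, fun B hB _ => minimalGenerators_subset Γ B hB⟩

theorem IsNumericalSemigroup.finite_minimalGenerators {Γ : AddSubmonoid ℕ}
    (hΓ : IsNumericalSemigroup Γ) : (minimalGenerators Γ).Finite := by
  obtain ⟨c, hc⟩ := hΓ.bddAbove
  have hmem : ∀ x, c < x → x ∈ Γ := by
    intro x hx
    by_contra h
    have : x ≤ c := hc h
    omega
  refine (Set.finite_Iic (2 * c + 1)).subset ?_
  rintro x ⟨_, _, hirr⟩
  by_contra h
  simp only [Set.mem_Iic, not_le] at h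
  rcases hirr (c + 1) (hmem _ (by omega)) (x - (c + 1)) (hmem _ (by omega)) (by omega) with h' | h'
    <;> omega

/-- The embedding dimension: the number of minimal generators (a finite number for a numerical
semigroup). -/
noncomputable def embeddingDimension (Γ : AddSubmonoid ℕ) : ℕ :=
  (minimalGenerators Γ).ncard

/-- The multiplicity: the smallest positive element. -/
noncomputable def multiplicityOf (Γ : AddSubmonoid ℕ) : ℕ :=
  sInf {x | x ∈ Γ ∧ 0 < x}

/-- The monoid homomorphism `(a_r)_r ↦ ∑ a_r r` from the free commutative monoid on the minimal
generators of `Γ`; its image is `Γ`. -/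
noncomputable def factorizationHom (Γ : AddSubmonoid ℕ) : (minimalGenerators Γ →₀ ℕ) →+ ℕ :=
  (Finsupp.linearCombination ℕ (fun r : minimalGenerators Γ => (r : ℕ))).toAddMonoidHom

/-- A presentation of `Γ`: a set of pairs generating, as a congruence, the kernel congruence
`{(a, b) | φ a = φ b}` of the factorization homomorphism `φ`. -/
def IsPresentation (Γ : AddSubmonoid ℕ)
    (ρ : Set ((minimalGenerators Γ →₀ ℕ) × (minimalGenerators Γ →₀ ℕ))) : Prop :=
  addConGen (fun a b => (a, b) ∈ ρ) = AddCon.ker (factorizationHom Γ)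

/-- A minimal presentation: a presentation that is minimal with respect to inclusion. -/
def IsMinimalPresentation (Γ : AddSubmonoid ℕ)
    (ρ : Set ((minimalGenerators Γ →₀ ℕ) × (minimalGenerators Γ →₀ ℕ))) : Prop :=
  Minimal (IsPresentation Γ) ρ

/-- `Γ` is a complete intersection if it has a minimal presentation of cardinality `e(Γ) - 1`.
The cardinality is taken in `ℕ∞`, so that such a presentation is finite. -/
def IsCompleteIntersection (Γ : AddSubmonoid ℕ) : Prop :=
  ∃ ρ, IsMinimalPresentation Γ ρ ∧ ρ.encard + 1 = (embeddingDimension Γ : ℕ∞)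

/-- The submonoid `⟨2^n, 2^n + 1, 2^n + 2, 2^n + 2^2, …, 2^n + 2^(n-1)⟩` of `ℕ`. -/
def binaryFamily (n : ℕ) : AddSubmonoid ℕ :=
  AddSubmonoid.closure ({2 ^ n} ∪ {x | ∃ i < n, x = 2 ^ n + 2 ^ i})

/-! Lower bound: weight each variable by its generator. A presentation makes the quotient of `ℚ[x]`
by the binomials `x^p - x^q` the semigroup algebra of `Γ`, with every graded piece of dimension at
most 1. Imposing a homogeneous relation of degree `d` multiplies the Hilbert series at `t` in `[0,
1)` by at least `1 - t^d`. With `e - 1` relations of degrees `d_r` this gives `∏ (1 - t^d_r) / ∏ (1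
- t^w_j) ≤ 1 / (1 - t)`, and `t → 1` yields `∏ d_r ≤ ∏ w_j` (`prod_weight_le_prod`).

In the other direction, Hall's marriage theorem matches each generator `w_j` other than the
multiplicity with its own relation of degree at least `2 w_j` (`two_pow_card_le_of_relations`). Both
sides of a relation have degree at least two as monomials, so a relation of weight below `2 w_i`
dies once all variables lighter than `w_i` are set to zero. The remaining quotient is
finite-dimensional, so at least as many relations survive as variables
(`card_compl_le_card_of_eventually_eq_bot`), which is Hall's condition. Cancelling in `∏ 2 w_j ≤ ∏
d_r ≤ ∏ w_j` leaves `2^(e-1)` at most the multiplicity.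

Sharpness: in `binaryFamily n` the `n` relations `2 (2^n + 2^i) = (2^n + 2^(i+1)) + 2^n` rewrite
each monomial to one with exponents at most 1 away from `2^n`; uniqueness of binary digits makes
this a normal form, so they form a presentation. None is redundant because no other relation can be
applied to `2 • binaryFactor n i`. -/

/-! ### General tools: products of series and rank-nullity. -/

open Finset in
theorem ENNReal.tsum_fin_prod (n : ℕ) (f : Fin n → ℕ → ENNReal) :
    ∑' a : Fin n → ℕ, ∏ j, f j (a j) = ∏ j, ∑' k, f j k := by
  induction n with
  | zero => simp
  | succ n ih =>
    rw [← (Fin.consEquiv (fun _ : Fin (n + 1) => ℕ)).tsum_eq, ENNReal.tsum_prod', Fin.prod_univ_succ,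
      ← ih, ← ENNReal.tsum_mul_right]
    refine tsum_congr fun k => ?_
    rw [← ENNReal.tsum_mul_left]
    refine tsum_congr fun a => ?_
    rw [Fin.prod_univ_succ]
    simp [Fin.consEquiv]

/-- Expands a product of one-variable series over all monomials; working in `ENNReal` removes every
summability question. -/
theorem ENNReal.tsum_finsupp_prod {ι : Type*} [Fintype ι] (f : ι → ℕ → ENNReal) :
    ∑' a : ι →₀ ℕ, ∏ j, f j (a j) = ∏ j, ∑' k, f j k := by
  let e := Fintype.equivFin ι
  let E : (Fin (Fintype.card ι) → ℕ) ≃ (ι →₀ ℕ) :=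
    (e.arrowCongr (Equiv.refl ℕ)).symm.trans Finsupp.equivFunOnFinite.symm
  rw [← E.tsum_eq, ← e.symm.prod_comp, ← ENNReal.tsum_fin_prod]
  refine tsum_congr fun a => ?_
  rw [← e.symm.prod_comp]
  simp [E]

theorem Submodule.finrank_le_finrank_inf_ker_add {K E : Type*} [Field K] [AddCommGroup E]
    [Module K E] (W W' : Submodule K E) [FiniteDimensional K W] [FiniteDimensional K W']
    (T : E →ₗ[K] E) (hT : ∀ x ∈ W, T x ∈ W') :
    Module.finrank K W ≤ Module.finrank K (W ⊓ LinearMap.ker T : Submodule K E) +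
      Module.finrank K W' := by
  let S : W →ₗ[K] W' := T.restrict hT
  have h := S.finrank_range_add_finrank_ker
  have h1 : Module.finrank K (LinearMap.ker S) =
      Module.finrank K (W ⊓ LinearMap.ker T : Submodule K E) := by
    have : LinearMap.ker S = (W ⊓ LinearMap.ker T).comap W.subtype := by
      ext x
      simp [S, ← Subtype.coe_inj]
    rw [this]
    exact (Submodule.comapSubtypeEquivOfLe inf_le_left).finrank_eq
  have h2 := LinearMap.finrank_range_le S
  have h3 : Module.finrank K (LinearMap.range S) ≤ Module.finrank K W' :=
    Submodule.finrank_le _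
  omega

/-! ### Duals of graded quotients of polynomial rings. -/

/-- The functions on monomials (with weights `w`) that are supported on monomials of weight `n`
avoiding the variables in `J`, and that are invariant under the relations in `R`. This is the dual
of the degree `n` part of the algebra `ℚ[x] / (x_j, x^p - x^q | j ∈ J, (p, q) ∈ R)`. -/
def invariantFunctions {ι : Type*} (w : ι → ℕ) (J : Set ι) (R : Set ((ι →₀ ℕ) × (ι →₀ ℕ))) (n : ℕ) :
    Submodule ℚ ((ι →₀ ℕ) → ℚ) where
  carrier := {F | (∀ a, F a ≠ 0 → Finsupp.weight w a = n ∧ ∀ j ∈ J, a j = 0) ∧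
    ∀ r ∈ R, ∀ c, F (r.1 + c) = F (r.2 + c)}
  zero_mem' := by simp
  add_mem' := by
    rintro F G ⟨hF, hF'⟩ ⟨hG, hG'⟩
    refine ⟨fun a ha => ?_, fun r hr c => ?_⟩
    · by_cases h : F a = 0
      · exact hG a (by simpa [h] using ha)
      · exact hF a h
    · simp [hF' r hr c, hG' r hr c]
  smul_mem' := by
    rintro k F ⟨hF, hF'⟩
    refine ⟨fun a ha => hF a ?_, fun r hr c => ?_⟩
    · intro h
      simp [h] at ha
    · simp [hF' r hr c]

section

variable {ι : Type*} {w : ι → ℕ} {J : Set ι} {R : Set ((ι →₀ ℕ) × (ι →₀ ℕ))} {n : ℕ}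

theorem invariantFunctions_anti {R' : Set ((ι →₀ ℕ) × (ι →₀ ℕ))} (h : R ⊆ R') :
    invariantFunctions w J R' n ≤ invariantFunctions w J R n :=
  fun _ hF => ⟨hF.1, fun r hr => hF.2 r (h hr)⟩

/-- Functions invariant under no relation are just functions on a set of monomials. -/
noncomputable def invariantFunctionsEmptyEquiv (w : ι → ℕ) (J : Set ι) (n : ℕ) :
    invariantFunctions w J ∅ n ≃ₗ[ℚ]
      ({a : ι →₀ ℕ | Finsupp.weight w a = n ∧ ∀ j ∈ J, a j = 0} → ℚ) where
  toFun F a := F.1 a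
  map_add' _ _ := rfl
  map_smul' _ _ := rfl
  invFun f := ⟨fun a => by
      classical
      exact if h : Finsupp.weight w a = n ∧ ∀ j ∈ J, a j = 0 then f ⟨a, h⟩ else 0, by
    refine ⟨fun a ha => ?_, by simp⟩
    by_contra h
    simp [h] at ha⟩
  left_inv F := by
    ext a
    by_cases h : Finsupp.weight w a = n ∧ ∀ j ∈ J, a j = 0
    · simp only [dif_pos h]
    · simp only [dif_neg h]
      by_contra h'
      exact h (F.2.1 a (Ne.symm h'))
  right_inv f := by
    ext ⟨a, h⟩
    simp only [Set.mem_ofPred_eq] at h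
    simp only [dif_pos h]

variable [Finite ι]

theorem finite_monomials (hw : ∀ j, w j ≠ 0) (J : Set ι) (n : ℕ) :
    {a : ι →₀ ℕ | Finsupp.weight w a = n ∧ ∀ j ∈ J, a j = 0}.Finite :=
  (Finsupp.finite_of_nat_weight_eq w hw n).subset fun _ h => h.1

theorem finiteDimensional_invariantFunctions (hw : ∀ j, w j ≠ 0) :
    FiniteDimensional ℚ (invariantFunctions w J R n) := by
  have := (finite_monomials hw J n).to_subtype
  have : FiniteDimensional ℚ (invariantFunctions w J ∅ n) :=
    (invariantFunctionsEmptyEquiv w J n).symm.finiteDimensional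
  exact Submodule.finiteDimensional_of_le (invariantFunctions_anti (Set.empty_subset R))

theorem finrank_invariantFunctions_empty (hw : ∀ j, w j ≠ 0) :
    Module.finrank ℚ (invariantFunctions w J ∅ n) =
      {a : ι →₀ ℕ | Finsupp.weight w a = n ∧ ∀ j ∈ J, a j = 0}.ncard := by
  have := (finite_monomials hw J n).fintype
  rw [(invariantFunctionsEmptyEquiv w J n).finrank_eq, Module.finrank_pi, Set.ncard_eq_toFinset_card',
    Set.toFinset_card]

/-- Dual to the exact sequence `A(-d) → A → A/(f) → 0` for a homogeneous `f` of degree `d`: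
multiplication by `f` need not be injective, hence only an inequality. -/
theorem finrank_invariantFunctions_le_insert (hw : ∀ j, w j ≠ 0) {r : (ι →₀ ℕ) × (ι →₀ ℕ)}
    (hr : Finsupp.weight w r.1 = Finsupp.weight w r.2) :
    Module.finrank ℚ (invariantFunctions w J R n) ≤
      Module.finrank ℚ (invariantFunctions w J (insert r R) n) +
        if Finsupp.weight w r.1 ≤ n then
          Module.finrank ℚ (invariantFunctions w J R (n - Finsupp.weight w r.1)) else 0 := by
  -- The transpose of multiplication by `x^r.1 - x^r.2`; its kernel adds exactly the invariance
  -- under `r`.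
  let T : ((ι →₀ ℕ) → ℚ) →ₗ[ℚ] ((ι →₀ ℕ) → ℚ) :=
    LinearMap.funLeft ℚ ℚ (r.1 + ·) - LinearMap.funLeft ℚ ℚ (r.2 + ·)
  have hTapp : ∀ F c, T F c = F (r.1 + c) - F (r.2 + c) := fun F c => rfl
  have hker : invariantFunctions w J R n ⊓ LinearMap.ker T ≤
      invariantFunctions w J (insert r R) n := by
    rintro F ⟨hF, hT⟩
    refine ⟨hF.1, fun s hs c => ?_⟩
    rcases hs with rfl | hs
    · have := congrFun (LinearMap.mem_ker.1 hT) c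
      rw [hTapp] at this
      exact sub_eq_zero.1 this
    · exact hF.2 s hs c
  have := finiteDimensional_invariantFunctions (J := J) (R := R) (n := n) hw
  have := finiteDimensional_invariantFunctions (J := J) (R := insert r R) (n := n) hw
  -- `T` lowers the degree by the common weight of both sides of `r`, and so vanishes when that
  -- weight exceeds `n`.
  have hsupp : ∀ F ∈ invariantFunctions w J R n, ∀ c, T F c ≠ 0 →
      Finsupp.weight w r.1 + Finsupp.weight w c = n ∧ ∀ j ∈ J, c j = 0 := by
    intro F hF c hc
    have : F (r.1 + c) ≠ 0 ∨ F (r.2 + c) ≠ 0 := by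
      by_contra! h
      simp [hTapp, h] at hc
    rcases this with h | h
    · have := hF.1 _ h
      simp only [map_add, Finsupp.add_apply, Nat.add_eq_zero_iff] at this
      exact ⟨this.1, fun j hj => (this.2 j hj).2⟩
    · have := hF.1 _ h
      simp only [map_add, Finsupp.add_apply, Nat.add_eq_zero_iff] at this
      exact ⟨hr ▸ this.1, fun j hj => (this.2 j hj).2⟩
  split_ifs with h
  · have := finiteDimensional_invariantFunctions (J := J) (R := R)
      (n := n - Finsupp.weight w r.1) hw
    refine (Submodule.finrank_le_finrank_inf_ker_add _
      (invariantFunctions w J R (n - Finsupp.weight w r.1)) T fun F hF => ?_).trans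
      (Nat.add_le_add_right (Submodule.finrank_mono hker) _)
    refine ⟨fun c hc => ?_, fun s hs c => ?_⟩
    · have := hsupp F hF c hc
      exact ⟨by omega, this.2⟩
    · rw [hTapp, hTapp, add_left_comm, hF.2 s hs, add_left_comm, add_left_comm r.2, hF.2 s hs,
        add_left_comm r.2]
  · rw [add_zero]
    refine Submodule.finrank_mono (le_trans (le_inf le_rfl fun F hF => ?_) hker)
    rw [LinearMap.mem_ker]
    ext c
    by_contra hc
    have := hsupp F hF c hc
    omega

end

/-! ### Hilbert series and their behaviour at `t = 1`. -/

/-- The Hilbert series of `invariantFunctions w J R`, evaluated at `t`. -/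
noncomputable def invariantSeries {ι : Type*} (w : ι → ℕ) (J : Set ι)
    (R : Set ((ι →₀ ℕ) × (ι →₀ ℕ))) (t : ENNReal) : ENNReal :=
  ∑' n, (Module.finrank ℚ (invariantFunctions w J R n) : ENNReal) * t ^ n

/-- Summing by degree is summing over all monomials, and that sum factors over the variables; a
variable in `J` contributes only its exponent 0. -/
theorem invariantSeries_empty {ι : Type*} [Fintype ι] [DecidableEq ι] {w : ι → ℕ}
    (hw : ∀ j, w j ≠ 0) (J : Finset ι) (t : ENNReal) :
    invariantSeries w J ∅ t = ∏ j ∈ Jᶜ, (1 - t ^ w j)⁻¹ := by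
  have h1 : ∀ n, (Module.finrank ℚ (invariantFunctions w J ∅ n) : ENNReal) * t ^ n =
      ∑' a : ι →₀ ℕ, if n = Finsupp.weight w a then
        (if ∀ j ∈ J, a j = 0 then t ^ n else 0) else 0 := by
    intro n
    rw [finrank_invariantFunctions_empty hw, ← ENat.toENNReal_coe,
      (finite_monomials hw _ n).cast_ncard_eq, ← ENNReal.tsum_set_const, tsum_subtype _ fun _ => t ^ n]
    refine tsum_congr fun a => ?_
    rw [Set.indicator_apply, ← ite_and]
    simp [eq_comm]
  have h2 : ∀ j, ∑' k, (if j ∈ J then (if k = 0 then 1 else 0) else (t ^ w j) ^ k) =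
      if j ∈ J then 1 else (1 - t ^ w j)⁻¹ := by
    intro j
    split_ifs
    · rw [tsum_ite_eq]
    · exact ENNReal.tsum_geometric _
  rw [invariantSeries, tsum_congr h1, ENNReal.tsum_comm]
  simp_rw [tsum_ite_eq]
  have h3 : ∏ j ∈ Jᶜ, (1 - t ^ w j)⁻¹ = ∏ j, if j ∈ J then 1 else (1 - t ^ w j)⁻¹ := by
    rw [Finset.prod_ite, Finset.prod_const_one, one_mul]
    congr 1
    ext; simp
  rw [h3, ← Finset.prod_congr rfl fun j _ => h2 j, ← ENNReal.tsum_finsupp_prod]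
  refine tsum_congr fun a => ?_
  split_ifs with h
  · rw [Finsupp.weight_eq_sum, ← Finset.prod_pow_eq_pow_sum]
    refine Finset.prod_congr rfl fun j _ => ?_
    split_ifs with h' h''
    · simp [h'']
    · exact absurd (h j h') h''
    · rw [← pow_mul, smul_eq_mul, mul_comm]
  · push Not at h
    obtain ⟨j, hj, hj'⟩ := h
    exact (Finset.prod_eq_zero (Finset.mem_univ j) (by simp [hj, hj'])).symm

theorem invariantSeries_anti {ι : Type*} [Finite ι] {w : ι → ℕ} (hw : ∀ j, w j ≠ 0) (J : Set ι)
    {R R' : Set ((ι →₀ ℕ) × (ι →₀ ℕ))} (h : R ⊆ R') (t : ENNReal) :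
    invariantSeries w J R' t ≤ invariantSeries w J R t := by
  refine ENNReal.tsum_le_tsum fun n => mul_le_mul_left ?_ _
  have := finiteDimensional_invariantFunctions (J := J) (R := R) (n := n) hw
  exact_mod_cast Submodule.finrank_mono (invariantFunctions_anti h)

theorem invariantSeries_ne_top {ι : Type*} [Fintype ι] {w : ι → ℕ} (hw : ∀ j, w j ≠ 0)
    (J : Finset ι) (R : Set ((ι →₀ ℕ) × (ι →₀ ℕ))) {t : ENNReal} (ht : t < 1) :
    invariantSeries w J R t ≠ ⊤ := by
  classical
  refine ne_top_of_le_ne_top ?_ (invariantSeries_anti hw J (Set.empty_subset R) t)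
  rw [invariantSeries_empty hw]
  refine ENNReal.prod_ne_top fun j _ => ?_
  rw [ENNReal.inv_ne_top]
  exact (tsub_pos_of_lt (pow_lt_one₀ zero_le ht (hw j))).ne'

/-- Sums `finrank_invariantFunctions_le_insert` over all degrees. Since `t < 1`, the series is
finite, which lets multiplication distribute over the truncated subtraction. -/
theorem invariantSeries_le_insert {ι : Type*} [Fintype ι] {w : ι → ℕ} (hw : ∀ j, w j ≠ 0)
    (J : Finset ι) (R : Set ((ι →₀ ℕ) × (ι →₀ ℕ))) {r : (ι →₀ ℕ) × (ι →₀ ℕ)}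
    (hr : Finsupp.weight w r.1 = Finsupp.weight w r.2) {t : ENNReal} (ht : t < 1) :
    (1 - t ^ Finsupp.weight w r.1) * invariantSeries w J R t ≤
      invariantSeries w J (insert r R) t := by
  rw [ENNReal.sub_mul fun _ _ => invariantSeries_ne_top hw J R ht, one_mul, tsub_le_iff_right]
  set d := Finsupp.weight w r.1
  have hshift : t ^ d * invariantSeries w J R t = ∑' n, ((if d ≤ n then
      Module.finrank ℚ (invariantFunctions w J R (n - d)) else 0 : ℕ) : ENNReal) * t ^ n := by
    rw [invariantSeries, ← ENNReal.tsum_mul_left,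
      ← (add_left_injective d).tsum_eq (f := fun n => ((if d ≤ n then
      Module.finrank ℚ (invariantFunctions w J R (n - d)) else 0 : ℕ) : ENNReal) * t ^ n)]
    · refine tsum_congr fun n => ?_
      rw [if_pos (Nat.le_add_left d n), Nat.add_sub_cancel, pow_add]
      ring
    · intro n hn
      refine ⟨n - d, Nat.sub_add_cancel ?_⟩
      by_contra h
      simp [h] at hn
  rw [hshift, invariantSeries, invariantSeries, ← ENNReal.tsum_add]
  refine ENNReal.tsum_le_tsum fun n => ?_
  rw [← add_mul]
  refine mul_le_mul_left ?_ _
  exact_mod_cast finrank_invariantFunctions_le_insert hw hr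

theorem prod_mul_invariantSeries_empty_le {ι : Type*} [Fintype ι] {w : ι → ℕ}
    (hw : ∀ j, w j ≠ 0) (J : Finset ι) (R : Finset ((ι →₀ ℕ) × (ι →₀ ℕ)))
    (hR : ∀ r ∈ R, Finsupp.weight w r.1 = Finsupp.weight w r.2) {t : ENNReal} (ht : t < 1) :
    (∏ r ∈ R, (1 - t ^ Finsupp.weight w r.1)) * invariantSeries w J ∅ t ≤
      invariantSeries w J R t := by
  classical
  induction R using Finset.induction_on with
  | empty => simp
  | insert r R hrR ih =>
    rw [Finset.prod_insert hrR, mul_assoc, Finset.coe_insert]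
    exact (mul_le_mul_right (ih fun s hs => hR s (Finset.mem_insert_of_mem hs)) _).trans
      (invariantSeries_le_insert hw J R (hR r (Finset.mem_insert_self r R)) ht)

theorem prod_le_invariantSeries_mul_prod {ι : Type*} [Fintype ι] [DecidableEq ι] {w : ι → ℕ}
    (hw : ∀ j, w j ≠ 0) (J : Finset ι) (R : Finset ((ι →₀ ℕ) × (ι →₀ ℕ)))
    (hR : ∀ r ∈ R, Finsupp.weight w r.1 = Finsupp.weight w r.2) {x : ℝ} (hx0 : 0 ≤ x)
    (hx : x < 1) :
    ∏ r ∈ R, (1 - x ^ Finsupp.weight w r.1) ≤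
      (invariantSeries w J R (ENNReal.ofReal x)).toReal * ∏ j ∈ Jᶜ, (1 - x ^ w j) := by
  have ht : ENNReal.ofReal x < 1 := by simpa using hx
  have h := ENNReal.toReal_mono (invariantSeries_ne_top hw J R ht)
    (prod_mul_invariantSeries_empty_le hw J R hR ht)
  have hsub : ∀ k, (1 - ENNReal.ofReal x ^ k).toReal = 1 - x ^ k := by
    intro k
    rw [ENNReal.toReal_sub_of_le (pow_le_one₀ zero_le ht.le) (by simp)]
    simp [hx0]
  rw [invariantSeries_empty hw, ENNReal.toReal_mul, ENNReal.toReal_prod, ENNReal.toReal_prod] at h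
  simp only [ENNReal.toReal_inv, hsub, Finset.prod_inv_distrib] at h
  rwa [← div_eq_mul_inv, div_le_iff₀] at h
  exact Finset.prod_pos fun j _ => sub_pos.2 (pow_lt_one₀ hx0 hx (hw j))

-- Each `1 - x^m` is `1 - x` times a geometric sum with value `m` at 1. Cancel `(1 - x)^(s.card +
-- a)` and let `x → 1` from the left: the `k` surplus factors on the right become `0 ^ k`, which is
-- 1 for `k = 0` and kills the bound otherwise.
open Filter Topology in
theorem prod_le_of_prod_one_sub_pow_le {α β : Type*} {s : Finset α} {K : Finset β} {d : α → ℕ}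
    {v : β → ℕ} {C : ℝ} {a k : ℕ} (hK : K.card = s.card + a + k)
    (h : ∀ x : ℝ, 0 ≤ x → x < 1 →
      (1 - x) ^ a * ∏ i ∈ s, (1 - x ^ d i) ≤ C * ∏ j ∈ K, (1 - x ^ v j)) :
    ∏ i ∈ s, (d i : ℝ) ≤ C * 0 ^ k * ∏ j ∈ K, (v j : ℝ) := by
  have hgeom : ∀ (x : ℝ) (m : ℕ), 1 - x ^ m = (1 - x) * ∑ i ∈ Finset.range m, x ^ i :=
    fun x m => (mul_neg_geom_sum x m).symm
  let f : ℝ → ℝ := fun x => ∏ i ∈ s, ∑ l ∈ Finset.range (d i), x ^ l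
  let g : ℝ → ℝ := fun x => C * (1 - x) ^ k * ∏ j ∈ K, ∑ l ∈ Finset.range (v j), x ^ l
  have hf : Continuous f := by fun_prop
  have hg : Continuous g := by fun_prop
  have hfg : ∀ᶠ x in 𝓝[<] (1 : ℝ), f x ≤ g x := by
    filter_upwards [Ioo_mem_nhdsLT (zero_lt_one' ℝ)] with x hx
    have hx1 : 0 < 1 - x := sub_pos.2 hx.2
    have := h x hx.1.le hx.2
    simp only [hgeom, Finset.prod_mul_distrib, Finset.prod_const, hK] at this
    refine le_of_mul_le_mul_left ?_ (pow_pos hx1 (s.card + a))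
    calc (1 - x) ^ (s.card + a) * f x
        = (1 - x) ^ a * ((1 - x) ^ s.card * f x) := by ring
      _ ≤ _ := this
      _ = (1 - x) ^ (s.card + a) * g x := by simp only [g]; ring
  have h1 := le_of_tendsto_of_tendsto (hf.continuousWithinAt.tendsto)
    (hg.continuousWithinAt.tendsto) hfg
  simpa [f, g] using h1

/-! ### Degrees of relations and the matching argument. -/

/-- A binomial whose two monomials both involve a variable of `J` is already zero modulo `J`, so it
can be discarded. -/
theorem invariantFunctions_filter_eq {ι : Type*} {w : ι → ℕ}
    {R : Finset ((ι →₀ ℕ) × (ι →₀ ℕ))} {J : Finset ι}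
    (P : (ι →₀ ℕ) × (ι →₀ ℕ) → Prop) [DecidablePred P]
    (hP : ∀ r ∈ R, ¬ P r → (∃ j ∈ J, r.1 j ≠ 0) ∧ ∃ j ∈ J, r.2 j ≠ 0) (n : ℕ) :
    invariantFunctions w J (R.filter P) n = invariantFunctions w J R n := by
  refine le_antisymm (fun F hF => ⟨hF.1, fun r hr c => ?_⟩)
    (invariantFunctions_anti (Finset.coe_subset.2 (R.filter_subset P)))
  by_cases h : P r
  · exact hF.2 r (by simpa [h] using hr) c
  · have hz : ∀ p : ι →₀ ℕ, (∃ j ∈ J, p j ≠ 0) → F (p + c) = 0 := by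
      rintro p ⟨j, hj, hpj⟩
      by_contra hne
      have := (hF.1 _ hne).2 j hj
      rw [Finsupp.add_apply] at this
      omega
    rw [hz _ (hP r hr h).1, hz _ (hP r hr h).2]

section

variable {ι : Type*} [Fintype ι] {w : ι → ℕ} {R : Finset ((ι →₀ ℕ) × (ι →₀ ℕ))}

theorem prod_weight_le_prod (hw : ∀ j, w j ≠ 0)
    (hR : ∀ r ∈ R, Finsupp.weight w r.1 = Finsupp.weight w r.2)
    (hcard : Fintype.card ι = R.card + 1)
    (hone : ∀ n, Module.finrank ℚ (invariantFunctions w ∅ R n) ≤ 1) :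
    ∏ r ∈ R, Finsupp.weight w r.1 ≤ ∏ j, w j := by
  classical
  have := prod_le_of_prod_one_sub_pow_le (s := R) (K := Finset.univ)
    (d := fun r => Finsupp.weight w r.1) (v := w) (C := 1) (a := 1) (k := 0)
    (by rw [Finset.card_univ, hcard]) fun x hx0 hx => by
      have h := prod_le_invariantSeries_mul_prod hw ∅ R hR hx0 hx
      have ht : ENNReal.ofReal x < 1 := by simpa using hx
      have hs : invariantSeries w ∅ R (ENNReal.ofReal x) ≤ (1 - ENNReal.ofReal x)⁻¹ := by
        rw [← ENNReal.tsum_geometric]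
        refine ENNReal.tsum_le_tsum fun n => mul_le_of_le_one_left zero_le ?_
        exact_mod_cast hone n
      have hs' := ENNReal.toReal_mono
        (ENNReal.inv_ne_top.2 (tsub_pos_of_lt ht).ne') hs
      rw [ENNReal.toReal_inv, ENNReal.toReal_sub_of_le ht.le (by simp), ENNReal.toReal_one,
        ENNReal.toReal_ofReal hx0] at hs'
      have hx1 : 0 < 1 - x := sub_pos.2 hx
      rw [Finset.compl_empty, Finset.coe_empty] at h
      have hp : 0 ≤ ∏ j, (1 - x ^ w j) :=
        Finset.prod_nonneg fun j _ => sub_nonneg.2 (pow_le_one₀ hx0 hx.le)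
      calc (1 - x) ^ 1 * ∏ r ∈ R, (1 - x ^ Finsupp.weight w r.1)
          ≤ (1 - x) ^ 1 * ((1 - x)⁻¹ * ∏ j, (1 - x ^ w j)) := by gcongr; exact h.trans (by gcongr)
        _ = 1 * ∏ j, (1 - x ^ w j) := by field_simp
  simp only [pow_zero, mul_one, one_mul] at this
  exact_mod_cast this

/-- If only finitely many degrees of the quotient by the variables in `J` and the relations `R` are
nonzero, then at least as many relations as variables survive modulo `J`. -/
theorem card_compl_le_card_of_eventually_eq_bot [DecidableEq ι] (hw : ∀ j, w j ≠ 0)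
    (hR : ∀ r ∈ R, Finsupp.weight w r.1 = Finsupp.weight w r.2) (hR0 : ∀ r ∈ R, r.1 ≠ 0)
    {J : Finset ι} {N : ℕ} (hN : ∀ n, N ≤ n → invariantFunctions w J R n = ⊥) :
    Jᶜ.card ≤ R.card := by
  by_contra! hlt
  obtain ⟨k, hk⟩ := Nat.exists_eq_add_of_lt hlt
  set C : ℕ := ∑ n ∈ Finset.range N, Module.finrank ℚ (invariantFunctions w J R n)
  -- With fewer relations than surviving variables, `k + 1` factors `1 - x` are left over, while the
  -- series stays below the total dimension `C`. The limit would force a product of positive weights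
  -- to be at most 0.
  have := prod_le_of_prod_one_sub_pow_le (s := R) (K := Jᶜ)
    (d := fun r => Finsupp.weight w r.1) (v := w) (C := C) (a := 0) (k := k + 1)
    (by omega) fun x hx0 hx => by
      have h := prod_le_invariantSeries_mul_prod hw J R hR hx0 hx
      have hs : invariantSeries w J R (ENNReal.ofReal x) ≤ C := by
        rw [invariantSeries, tsum_eq_sum (s := Finset.range N)]
        · simp only [C, Nat.cast_sum]
          exact Finset.sum_le_sum fun n _ =>
            mul_le_of_le_one_right zero_le (pow_le_one₀ zero_le (by simpa using hx.le))
        · intro n hn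
          rw [Finset.mem_range, not_lt] at hn
          rw [hN n hn, finrank_bot, Nat.cast_zero, zero_mul]
      have hs' := ENNReal.toReal_mono (ENNReal.natCast_ne_top C) hs
      rw [ENNReal.toReal_natCast] at hs'
      rw [pow_zero, one_mul]
      exact h.trans (mul_le_mul_of_nonneg_right hs'
        (Finset.prod_nonneg fun j _ => sub_nonneg.2 (pow_le_one₀ hx0 hx.le)))
  rw [pow_succ, mul_zero, mul_zero, zero_mul] at this
  refine absurd this (not_le.2 (Finset.prod_pos fun r hr => ?_))
  have hnt : Finsupp.NonTorsionWeight ℕ w := Finsupp.nonTorsionWeight_of ℕ w hw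
  exact_mod_cast Nat.pos_of_ne_zero fun h => hR0 r hr ((Finsupp.weight_eq_zero_iff_eq_zero w).1 h)

/-- At least two factors, each of weight at least `v`, would already weigh `2 * v`. -/
theorem exists_lt_of_weight_lt {v : ℕ} {p : ι →₀ ℕ} (hp : 2 ≤ p.degree)
    (h : Finsupp.weight w p < 2 * v) : ∃ j, w j < v ∧ p j ≠ 0 := by
  by_contra! hv
  refine absurd h (not_lt.2 ?_)
  calc 2 * v ≤ p.degree * v := Nat.mul_le_mul_right v hp
    _ = ∑ j, p j * v := by rw [Finsupp.degree_eq_sum, Finset.sum_mul]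
    _ ≤ Finsupp.weight w p := by
      rw [Finsupp.weight_eq_sum]
      refine Finset.sum_le_sum fun j _ => ?_
      by_cases hj : v ≤ w j
      · exact Nat.mul_le_mul_left _ hj
      · simp [hv j (not_le.1 hj)]

theorem two_pow_card_le_of_relations (hw : ∀ j, w j ≠ 0) (hinj : Function.Injective w)
    (hR : ∀ r ∈ R, Finsupp.weight w r.1 = Finsupp.weight w r.2)
    (hdeg : ∀ r ∈ R, 2 ≤ r.1.degree ∧ 2 ≤ r.2.degree)
    (hcard : Fintype.card ι = R.card + 1)
    (hone : ∀ n, Module.finrank ℚ (invariantFunctions w ∅ R n) ≤ 1)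
    {j₀ : ι} (hmin : ∀ j, w j₀ ≤ w j) {N : ℕ}
    (hN : ∀ J : Set ι, j₀ ∈ J → ∀ n, N ≤ n → invariantFunctions w J R n = ⊥) :
    2 ^ (Fintype.card ι - 1) ≤ w j₀ := by
  classical
  have hR0 : ∀ r ∈ R, r.1 ≠ 0 := by
    intro r hr h
    have := (hdeg r hr).1
    simp [h] at this
  let t : {j // j ≠ j₀} → Finset ((ι →₀ ℕ) × (ι →₀ ℕ)) :=
    fun j => R.filter fun r => 2 * w j ≤ Finsupp.weight w r.1
  -- Hall's condition: the relations allowed for the lightest generator `i` of `A` already suffice,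
  -- because `A` lies in the complement of the set `J` of generators lighter than `i`. That set
  -- contains `j₀`, so the quotient modulo `J` is finite-dimensional.
  have hall : ∀ A : Finset {j // j ≠ j₀}, A.card ≤ (A.biUnion t).card := by
    intro A
    rcases A.eq_empty_or_nonempty with rfl | hA
    · simp
    obtain ⟨i, hiA, hi⟩ := A.exists_min_image (fun j => w j) hA
    refine le_trans ?_ (Finset.card_le_card (Finset.subset_biUnion_of_mem t hiA))
    let J : Finset ι := Finset.univ.filter fun j => w j < w i
    have hj₀ : j₀ ∈ J := by
      simp only [J, Finset.mem_filter, Finset.mem_univ, true_and]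
      exact lt_of_le_of_ne (hmin i) fun h => i.2 (hinj h).symm
    have hle : Jᶜ.card ≤ (t i).card := by
      refine card_compl_le_card_of_eventually_eq_bot (N := N) hw
        (fun r hr => hR r (Finset.mem_filter.1 hr).1)
        (fun r hr => hR0 r (Finset.mem_filter.1 hr).1) fun n hn => ?_
      rw [invariantFunctions_filter_eq, hN J (by simpa using hj₀) n hn]
      intro r hr hlt
      rw [not_le] at hlt
      have h1 := exists_lt_of_weight_lt (hdeg r hr).1 hlt
      have h2 := exists_lt_of_weight_lt (hdeg r hr).2 (hR r hr ▸ hlt)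
      simpa [J] using And.intro h1 h2
    refine le_trans ?_ hle
    rw [← Finset.card_map (Function.Embedding.subtype _)]
    refine Finset.card_le_card fun j hj => ?_
    obtain ⟨j', hj', rfl⟩ := Finset.mem_map.1 hj
    simpa [J] using hi j' hj'
  obtain ⟨f, hfinj, hf⟩ := (Finset.all_card_le_biUnion_card_iff_exists_injective t).1 hall
  have hf' : ∀ j, f j ∈ R ∧ 2 * w j ≤ Finsupp.weight w (f j).1 := fun j =>
    Finset.mem_filter.1 (hf j)
  have hnt : Finsupp.NonTorsionWeight ℕ w := Finsupp.nonTorsionWeight_of ℕ w hw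
  have h1 : ∏ j : {j // j ≠ j₀}, (2 * w j) ≤ ∏ j, w j := by
    refine le_trans ?_ (prod_weight_le_prod hw hR hcard hone)
    calc ∏ j : {j // j ≠ j₀}, (2 * w j)
        ≤ ∏ j : {j // j ≠ j₀}, Finsupp.weight w (f j).1 :=
          Finset.prod_le_prod' fun j _ => (hf' j).2
      _ = ∏ r ∈ Finset.univ.image f, Finsupp.weight w r.1 :=
          (Finset.prod_image (f := fun r : (ι →₀ ℕ) × (ι →₀ ℕ) => Finsupp.weight w r.1)
            fun _ _ _ _ h => hfinj h).symm
      _ ≤ ∏ r ∈ R, Finsupp.weight w r.1 := by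
          refine Finset.prod_le_prod_of_subset_of_one_le' ?_ fun r hr _ => ?_
          · intro r hr
            obtain ⟨j, _, rfl⟩ := Finset.mem_image.1 hr
            exact (hf' j).1
          · exact Nat.pos_of_ne_zero fun h =>
              hR0 r hr ((Finsupp.weight_eq_zero_iff_eq_zero w).1 h)
  rw [Finset.prod_mul_distrib, Finset.prod_const, Finset.card_univ,
    Fintype.prod_eq_mul_prod_subtype_ne w j₀] at h1
  have hc : Fintype.card {j // j ≠ j₀} = Fintype.card ι - 1 := by
    rw [Fintype.card_subtype_compl, Fintype.card_subtype_eq]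
  rw [← hc]
  exact le_of_mul_le_mul_right h1
    (Finset.prod_pos fun j _ => Nat.pos_of_ne_zero (hw j))

end

/-! ### From presentations of numerical semigroups to relations. -/

theorem factorizationHom_eq_weight (Γ : AddSubmonoid ℕ) :
    factorizationHom Γ = Finsupp.weight (fun r : minimalGenerators Γ => (r : ℕ)) := rfl

theorem factorizationHom_single (Γ : AddSubmonoid ℕ) (r : minimalGenerators Γ) (k : ℕ) :
    factorizationHom Γ (Finsupp.single r k) = k * r := by
  rw [factorizationHom_eq_weight, Finsupp.weight_single, smul_eq_mul]

theorem factorizationHom_mem (Γ : AddSubmonoid ℕ) (a : minimalGenerators Γ →₀ ℕ) :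
    factorizationHom Γ a ∈ Γ := by
  induction a using Finsupp.induction_linear with
  | zero => simp
  | add a b ha hb => rw [map_add]; exact add_mem ha hb
  | single r k =>
    rw [factorizationHom_single, ← smul_eq_mul]
    exact Γ.nsmul_mem r.2.1 k

theorem exists_factorizationHom_eq (Γ : AddSubmonoid ℕ) {x : ℕ} (hx : x ∈ Γ) :
    ∃ a, factorizationHom Γ a = x := by
  rw [← closure_minimalGenerators Γ] at hx
  induction hx using AddSubmonoid.closure_induction with
  | mem r hr => exact ⟨Finsupp.single ⟨r, hr⟩ 1, by simp [factorizationHom_single]⟩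
  | zero => exact ⟨0, map_zero _⟩
  | add x y _ _ ihx ihy =>
    obtain ⟨a, rfl⟩ := ihx
    obtain ⟨b, rfl⟩ := ihy
    exact ⟨a + b, map_add _ _ _⟩

theorem minimalGenerators_coe_ne_zero {Γ : AddSubmonoid ℕ} (r : minimalGenerators Γ) :
    (r : ℕ) ≠ 0 := r.2.2.1

theorem factorizationHom_eq_zero_iff {Γ : AddSubmonoid ℕ} {a : minimalGenerators Γ →₀ ℕ} :
    factorizationHom Γ a = 0 ↔ a = 0 := by
  have : Finsupp.NonTorsionWeight ℕ (fun r : minimalGenerators Γ => (r : ℕ)) :=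
    Finsupp.nonTorsionWeight_of ℕ _ minimalGenerators_coe_ne_zero
  exact Finsupp.weight_eq_zero_iff_eq_zero _

theorem exists_eq_single_add {α : Type*} {a : α →₀ ℕ} (ha : a ≠ 0) :
    ∃ i b, a = Finsupp.single i 1 + b := by
  obtain ⟨i, hi⟩ := Finsupp.ne_iff.1 ha
  refine ⟨i, a - Finsupp.single i 1, (add_tsub_cancel_of_le ?_).symm⟩
  rw [Finsupp.single_le_iff]
  exact Nat.one_le_iff_ne_zero.2 hi

theorem eq_single_of_factorizationHom_eq {Γ : AddSubmonoid ℕ} {j : minimalGenerators Γ}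
    {a : minimalGenerators Γ →₀ ℕ} (h : factorizationHom Γ a = j) : a = Finsupp.single j 1 := by
  have ha : a ≠ 0 := by
    rintro rfl
    exact minimalGenerators_coe_ne_zero j (by simpa using h.symm)
  obtain ⟨k, b, rfl⟩ := exists_eq_single_add ha
  rw [map_add, factorizationHom_single, one_mul] at h
  rcases j.2.2.2 k k.2.1 _ (factorizationHom_mem Γ b) h.symm with h' | h'
  · exact absurd h' (minimalGenerators_coe_ne_zero k)
  · rw [h', add_zero] at h
    rw [factorizationHom_eq_zero_iff.1 h', add_zero, Subtype.ext h]

/-- Both sides of a nontrivial relation between minimal generators have degree at least two. -/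
theorem two_le_degree_of_factorizationHom_eq {Γ : AddSubmonoid ℕ}
    {p q : minimalGenerators Γ →₀ ℕ} (h : factorizationHom Γ p = factorizationHom Γ q)
    (hpq : p ≠ q) : 2 ≤ p.degree := by
  by_contra! hlt
  have hp : p ≠ 0 := by
    rintro rfl
    rw [map_zero, eq_comm, factorizationHom_eq_zero_iff] at h
    exact hpq h.symm
  obtain ⟨k, b, rfl⟩ := exists_eq_single_add hp
  have hb : b = 0 := by
    rw [← Finsupp.degree_eq_zero_iff]
    rw [map_add, Finsupp.degree_single] at hlt
    omega
  subst hb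
  rw [add_zero] at h hpq
  rw [factorizationHom_single, one_mul] at h
  exact hpq (eq_single_of_factorizationHom_eq h.symm).symm

/-- A trivial pair adds nothing to the generated congruence, so minimality would drop it. -/
theorem IsMinimalPresentation.fst_ne_snd {Γ : AddSubmonoid ℕ}
    {ρ : Set ((minimalGenerators Γ →₀ ℕ) × (minimalGenerators Γ →₀ ℕ))}
    (hρ : IsMinimalPresentation Γ ρ) {r : (minimalGenerators Γ →₀ ℕ) × (minimalGenerators Γ →₀ ℕ)}
    (hr : r ∈ ρ) : r.1 ≠ r.2 := by
  intro heq
  have hpres : IsPresentation Γ (ρ \ {r}) := by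
    refine Eq.trans (le_antisymm ?_ ?_) hρ.prop
    · exact AddCon.addConGen_mono fun a b h => h.1
    · refine AddCon.addConGen_le.2 fun a b h => ?_
      by_cases hab : (a, b) = r
      · rw [← hab] at heq
        simp only at heq
        rw [heq]
        exact AddCon.refl _ b
      · exact AddConGen.Rel.of _ _ ⟨h, hab⟩
  exact (hρ.le_of_le hpres Set.sdiff_subset hr).2 rfl

theorem IsPresentation.factorizationHom_eq {Γ : AddSubmonoid ℕ}
    {ρ : Set ((minimalGenerators Γ →₀ ℕ) × (minimalGenerators Γ →₀ ℕ))}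
    (hρ : IsPresentation Γ ρ) {r : (minimalGenerators Γ →₀ ℕ) × (minimalGenerators Γ →₀ ℕ)}
    (hr : r ∈ ρ) : factorizationHom Γ r.1 = factorizationHom Γ r.2 := by
  have : addConGen (fun a b => (a, b) ∈ ρ) r.1 r.2 := AddConGen.Rel.of _ _ hr
  rw [hρ] at this
  exact this

/-- Translation-invariant identification of the arguments of a function. -/
def shiftCon {M : Type*} [AddCommMonoid M] {A : Type*} (F : M → A) : AddCon M where
  r a b := ∀ c, F (a + c) = F (b + c)
  iseqv := ⟨fun _ _ => rfl, fun h c => (h c).symm, fun h h' c => (h c).trans (h' c)⟩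
  add' := fun {a b c d} h h' e => by
    rw [add_assoc, h, add_left_comm, h', add_left_comm, add_assoc]

theorem IsPresentation.apply_eq_of_mem_invariantFunctions {Γ : AddSubmonoid ℕ}
    {ρ : Set ((minimalGenerators Γ →₀ ℕ) × (minimalGenerators Γ →₀ ℕ))}
    (hρ : IsPresentation Γ ρ) {J : Set (minimalGenerators Γ)} {n : ℕ}
    {F : (minimalGenerators Γ →₀ ℕ) → ℚ}
    (hF : F ∈ invariantFunctions (fun r : minimalGenerators Γ => (r : ℕ)) J ρ n)
    {a b : minimalGenerators Γ →₀ ℕ} (hab : factorizationHom Γ a = factorizationHom Γ b) :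
    F a = F b := by
  have hle : addConGen (fun a b => (a, b) ∈ ρ) ≤ shiftCon F :=
    AddCon.addConGen_le.2 fun a b h => hF.2 _ h
  rw [hρ] at hle
  have h : shiftCon F a b := hle hab
  simpa using h 0

/-- An invariant function is constant on the factorizations of `n`, hence determined by its value at
any one of them. -/
theorem IsPresentation.finrank_invariantFunctions_le_one {Γ : AddSubmonoid ℕ}
    {ρ : Set ((minimalGenerators Γ →₀ ℕ) × (minimalGenerators Γ →₀ ℕ))}
    (hρ : IsPresentation Γ ρ) (J : Set (minimalGenerators Γ)) (n : ℕ) :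
    Module.finrank ℚ (invariantFunctions (fun r : minimalGenerators Γ => (r : ℕ)) J ρ n) ≤ 1 := by
  by_cases h : ∃ a, factorizationHom Γ a = n
  · obtain ⟨a, ha⟩ := h
    let E : invariantFunctions (fun r : minimalGenerators Γ => (r : ℕ)) J ρ n →ₗ[ℚ] ℚ :=
      (LinearMap.proj a).comp (Submodule.subtype _)
    have hE : Function.Injective E := by
      rw [← LinearMap.ker_eq_bot, LinearMap.ker_eq_bot']
      rintro ⟨F, hF⟩ (h0 : F a = 0)
      ext b
      by_contra hb
      have : factorizationHom Γ b = n := (hF.1 b hb).1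
      exact hb ((hρ.apply_eq_of_mem_invariantFunctions hF (this.trans ha.symm)).trans h0)
    simpa using LinearMap.finrank_le_finrank_of_injective hE
  · have hbot : invariantFunctions (fun r : minimalGenerators Γ => (r : ℕ)) J ρ n = ⊥ := by
      rw [Submodule.eq_bot_iff]
      intro F hF
      ext b
      by_contra hb
      exact h ⟨b, (hF.1 b hb).1⟩
    rw [hbot, finrank_bot]
    exact zero_le_one

/-- Some factorization of `n + j` uses `j`, where the function must vanish; being constant on
factorizations, it vanishes on all of them. -/
theorem IsPresentation.invariantFunctions_eq_bot {Γ : AddSubmonoid ℕ}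
    {ρ : Set ((minimalGenerators Γ →₀ ℕ) × (minimalGenerators Γ →₀ ℕ))}
    (hρ : IsPresentation Γ ρ) {J : Set (minimalGenerators Γ)} {j : minimalGenerators Γ}
    (hj : j ∈ J) {n : ℕ} (hn : n ∈ Γ) :
    invariantFunctions (fun r : minimalGenerators Γ => (r : ℕ)) J ρ (n + j) = ⊥ := by
  obtain ⟨a, rfl⟩ := exists_factorizationHom_eq Γ hn
  rw [Submodule.eq_bot_iff]
  intro F hF
  ext b
  by_contra hb
  have hb' : factorizationHom Γ b = factorizationHom Γ (a + Finsupp.single j 1) := by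
    rw [map_add, factorizationHom_single, one_mul]
    exact (hF.1 b hb).1
  rw [hρ.apply_eq_of_mem_invariantFunctions hF hb'] at hb
  simpa using (hF.1 _ hb).2 j hj

theorem IsNumericalSemigroup.exists_forall_le_mem {Γ : AddSubmonoid ℕ}
    (hΓ : IsNumericalSemigroup Γ) : ∃ N, ∀ n, N ≤ n → n ∈ Γ := by
  obtain ⟨c, hc⟩ := hΓ.bddAbove
  refine ⟨c + 1, fun n hn => ?_⟩
  by_contra h
  have : n ≤ c := hc h
  omega

theorem IsNumericalSemigroup.multiplicityOf_isLeast {Γ : AddSubmonoid ℕ}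
    (hΓ : IsNumericalSemigroup Γ) : IsLeast {x | x ∈ Γ ∧ 0 < x} (multiplicityOf Γ) := by
  obtain ⟨N, hN⟩ := hΓ.exists_forall_le_mem
  exact ⟨Nat.sInf_mem ⟨N + 1, hN _ (Nat.le_succ N), N.succ_pos⟩, fun x hx => Nat.sInf_le hx⟩

theorem IsNumericalSemigroup.multiplicityOf_mem_minimalGenerators {Γ : AddSubmonoid ℕ}
    (hΓ : IsNumericalSemigroup Γ) : multiplicityOf Γ ∈ minimalGenerators Γ := by
  obtain ⟨⟨h1, h2⟩, h3⟩ := hΓ.multiplicityOf_isLeast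
  refine ⟨h1, h2.ne', fun y hy z hz h => ?_⟩
  by_contra! hyz
  have := h3 ⟨hy, Nat.pos_of_ne_zero hyz.1⟩
  omega

theorem IsCompleteIntersection.two_pow_le_multiplicityOf {Γ : AddSubmonoid ℕ}
    (hCI : IsCompleteIntersection Γ) (hΓ : IsNumericalSemigroup Γ) :
    2 ^ (embeddingDimension Γ - 1) ≤ multiplicityOf Γ := by
  obtain ⟨ρ, hρ, hcard⟩ := hCI
  have := hΓ.finite_minimalGenerators.fintype
  have hfin : ρ.Finite := by
    rw [← Set.encard_ne_top_iff]
    intro h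
    rw [h, top_add] at hcard
    exact ENat.top_ne_natCast _ hcard
  obtain ⟨R, rfl⟩ := hfin.exists_finset_coe
  have he : embeddingDimension Γ = Fintype.card (minimalGenerators Γ) := by
    rw [embeddingDimension, Set.ncard_eq_toFinset_card', Set.toFinset_card]
  rw [Set.encard_coe_eq_coe_finsetCard, he] at hcard
  obtain ⟨N, hN⟩ := hΓ.exists_forall_le_mem
  have hm := hΓ.multiplicityOf_mem_minimalGenerators
  have hw : ∀ r ∈ R, factorizationHom Γ r.1 = factorizationHom Γ r.2 := fun r hr =>
    hρ.prop.factorizationHom_eq hr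
  rw [he]
  refine two_pow_card_le_of_relations (w := fun r : minimalGenerators Γ => (r : ℕ)) (R := R)
    (j₀ := ⟨_, hm⟩) (N := N + multiplicityOf Γ) minimalGenerators_coe_ne_zero
    Subtype.coe_injective hw (fun r hr => ?_) (by exact_mod_cast hcard.symm)
    (hρ.prop.finrank_invariantFunctions_le_one ∅)
    (fun j => hΓ.multiplicityOf_isLeast.2 ⟨j.2.1, Nat.pos_of_ne_zero j.2.2.1⟩)
    fun J hJ n hn => ?_
  · exact ⟨two_le_degree_of_factorizationHom_eq (hw r hr) (hρ.fst_ne_snd hr),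
      two_le_degree_of_factorizationHom_eq (hw r hr).symm (hρ.fst_ne_snd hr).symm⟩
  · have := hρ.prop.invariantFunctions_eq_bot hJ (hN (n - multiplicityOf Γ) (by omega))
    rwa [Nat.sub_add_cancel (by omega)] at this

/-! ### Numerical invariants of the extremal family. -/

theorem two_pow_mem_binaryFamily (n : ℕ) : 2 ^ n ∈ binaryFamily n :=
  AddSubmonoid.subset_closure (Or.inl rfl)

theorem two_pow_add_two_pow_mem_binaryFamily {n i : ℕ} (hi : i < n) :
    2 ^ n + 2 ^ i ∈ binaryFamily n :=
  AddSubmonoid.subset_closure (Or.inr ⟨i, hi, rfl⟩)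

theorem eq_zero_or_two_pow_le_of_mem_binaryFamily {n x : ℕ} (hx : x ∈ binaryFamily n) :
    x = 0 ∨ 2 ^ n ≤ x := by
  induction hx using AddSubmonoid.closure_induction with
  | mem x hx =>
    right
    rcases hx with rfl | ⟨i, -, rfl⟩
    · exact le_rfl
    · exact Nat.le_add_right _ _
  | zero => exact Or.inl rfl
  | add x y _ _ hx hy => omega

/-- Every listed generator is below `2 * 2 ^ n`, whereas a sum of two nonzero elements is at least
that. -/
theorem minimalGenerators_binaryFamily (n : ℕ) :
    minimalGenerators (binaryFamily n) = {2 ^ n} ∪ {x | ∃ i < n, x = 2 ^ n + 2 ^ i} := by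
  refine Set.Subset.antisymm (minimalGenerators_subset _ _ rfl) fun x hx => ?_
  have hlt : x < 2 * 2 ^ n ∧ x ≠ 0 := by
    have := Nat.two_pow_pos n
    rcases hx with rfl | ⟨i, hi, rfl⟩
    · omega
    · have : 2 ^ i < 2 ^ n := Nat.pow_lt_pow_right one_lt_two hi
      have := Nat.two_pow_pos i
      omega
  refine ⟨AddSubmonoid.subset_closure hx, hlt.2, fun y hy z hz h => ?_⟩
  have := eq_zero_or_two_pow_le_of_mem_binaryFamily hy
  have := eq_zero_or_two_pow_le_of_mem_binaryFamily hz
  omega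

theorem embeddingDimension_binaryFamily (n : ℕ) :
    embeddingDimension (binaryFamily n) = n + 1 := by
  have h : ({2 ^ n} ∪ {x | ∃ i < n, x = 2 ^ n + 2 ^ i} : Set ℕ) =
      insert (2 ^ n) (((Finset.range n).image fun i => 2 ^ n + 2 ^ i : Finset ℕ) : Set ℕ) := by
    ext x
    simp [eq_comm]
  rw [embeddingDimension, minimalGenerators_binaryFamily, h, Set.ncard_insert_of_notMem,
    Set.ncard_coe_finset, Finset.card_image_of_injective, Finset.card_range]
  · exact fun i j hij => Nat.pow_right_injective le_rfl (Nat.add_left_cancel hij)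
  · simp

theorem isNumericalSemigroup_binaryFamily {n : ℕ} (hn : 1 ≤ n) :
    IsNumericalSemigroup (binaryFamily n) := by
  refine (Set.finite_lt_nat (2 ^ n * 2 ^ n)).subset fun x hx => ?_
  by_contra hlt
  refine hx ?_
  have hpos := Nat.two_pow_pos n
  have hlt : 2 ^ n * 2 ^ n ≤ x := not_lt.1 hlt
  have hq : 2 ^ n ≤ x / 2 ^ n := (Nat.le_div_iff_mul_le hpos).2 hlt
  have hr : x % 2 ^ n < 2 ^ n := Nat.mod_lt _ hpos
  -- The generators `2^n` and `2^n + 1` suffice once the quotient of `x` by `2^n` is at least the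
  -- remainder, which holds from `2^n * 2^n` on.
  have hx : x = (x / 2 ^ n - x % 2 ^ n) • 2 ^ n + (x % 2 ^ n) • (2 ^ n + 2 ^ 0) := by
    obtain ⟨k, hk⟩ := Nat.exists_eq_add_of_le (hr.le.trans hq)
    conv_lhs => rw [← Nat.div_add_mod x (2 ^ n)]
    rw [hk, Nat.add_sub_cancel_left, smul_eq_mul, smul_eq_mul]
    ring
  rw [hx]
  exact add_mem (AddSubmonoid.nsmul_mem _ (two_pow_mem_binaryFamily n) _)
    (AddSubmonoid.nsmul_mem _ (two_pow_add_two_pow_mem_binaryFamily hn) _)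

theorem multiplicityOf_binaryFamily (n : ℕ) : multiplicityOf (binaryFamily n) = 2 ^ n := by
  refine IsLeast.csInf_eq ⟨⟨two_pow_mem_binaryFamily n, Nat.two_pow_pos n⟩, fun x hx => ?_⟩
  have := eq_zero_or_two_pow_le_of_mem_binaryFamily hx.1
  have := hx.2
  omega

theorem binaryFamily_succ (n : ℕ) :
    binaryFamily (n + 1) = (binaryFamily n).map (AddMonoidHom.mulLeft 2) ⊔
      AddSubmonoid.multiples (2 ^ (n + 1) + 1) := by
  rw [binaryFamily, binaryFamily, AddMonoidHom.map_mclosure, AddSubmonoid.multiples_eq_closure,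
    ← AddSubmonoid.closure_union]
  congr 1
  ext x
  simp only [Set.mem_union, Set.mem_singleton_iff, Set.mem_ofPred_eq, Set.mem_image,
    AddMonoidHom.coe_mulLeft]
  constructor
  · rintro (rfl | ⟨i, hi, rfl⟩)
    · exact Or.inl ⟨2 ^ n, Or.inl rfl, by ring⟩
    · rcases i with _ | i
      · exact Or.inr rfl
      · exact Or.inl ⟨2 ^ n + 2 ^ i, Or.inr ⟨i, by omega, rfl⟩, by ring⟩
  · rintro (⟨y, rfl | ⟨i, hi, rfl⟩, rfl⟩ | rfl)
    · exact Or.inl (by ring)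
    · exact Or.inr ⟨i + 1, by omega, by ring⟩
    · exact Or.inr ⟨0, by omega, rfl⟩

/-! ### A minimal presentation of the extremal family. -/

/-- The generator `2 ^ n` of `binaryFamily n`. -/
def binaryBase (n : ℕ) : minimalGenerators (binaryFamily n) :=
  ⟨2 ^ n, by rw [minimalGenerators_binaryFamily]; exact Or.inl rfl⟩

/-- The generator `2 ^ n + 2 ^ i` of `binaryFamily n`. -/
def binaryGen {n i : ℕ} (hi : i < n) : minimalGenerators (binaryFamily n) :=
  ⟨2 ^ n + 2 ^ i, by rw [minimalGenerators_binaryFamily]; exact Or.inr ⟨i, hi, rfl⟩⟩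

theorem binaryGen_ne_binaryBase {n i : ℕ} (hi : i < n) : binaryGen hi ≠ binaryBase n := by
  intro h
  have : 2 ^ n + 2 ^ i = 2 ^ n := congrArg Subtype.val h
  have := Nat.two_pow_pos i
  omega

theorem binaryGen_inj {n i j : ℕ} (hi : i < n) (hj : j < n) :
    binaryGen hi = binaryGen hj ↔ i = j := by
  refine ⟨fun h => ?_, fun h => by subst h; rfl⟩
  have : 2 ^ n + 2 ^ i = 2 ^ n + 2 ^ j := congrArg Subtype.val h
  exact Nat.pow_right_injective le_rfl (Nat.add_left_cancel this)

/-- The factorization of `2 ^ n + 2 ^ i` for `i ≤ n`: a single generator for `i < n`, and twice the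
generator `2 ^ n` for `i = n`. -/
noncomputable def binaryFactor (n i : ℕ) : minimalGenerators (binaryFamily n) →₀ ℕ :=
  if hi : i < n then Finsupp.single (binaryGen hi) 1 else Finsupp.single (binaryBase n) 2

theorem binaryFactor_of_lt {n i : ℕ} (hi : i < n) :
    binaryFactor n i = Finsupp.single (binaryGen hi) 1 := dif_pos hi

theorem binaryFactor_self (n : ℕ) : binaryFactor n n = Finsupp.single (binaryBase n) 2 :=
  dif_neg (lt_irrefl n)

theorem factorizationHom_binaryFactor {n i : ℕ} (hi : i ≤ n) :
    factorizationHom _ (binaryFactor n i) = 2 ^ n + 2 ^ i := by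
  rcases hi.lt_or_eq with hi | rfl
  · rw [binaryFactor_of_lt hi, factorizationHom_single, one_mul]
    rfl
  · rw [binaryFactor_self, factorizationHom_single, two_mul]
    rfl

/-- The relation `2 (2 ^ n + 2 ^ i) = (2 ^ n + 2 ^ (i + 1)) + 2 ^ n`. -/
noncomputable def binaryRelation (n i : ℕ) :
    (minimalGenerators (binaryFamily n) →₀ ℕ) × (minimalGenerators (binaryFamily n) →₀ ℕ) :=
  (2 • binaryFactor n i, binaryFactor n (i + 1) + Finsupp.single (binaryBase n) 1)

/-- The relations `binaryRelation n i` for `i < n`. -/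
def binaryRelations (n : ℕ) :
    Set ((minimalGenerators (binaryFamily n) →₀ ℕ) × (minimalGenerators (binaryFamily n) →₀ ℕ)) :=
  binaryRelation n '' (Finset.range n : Set ℕ)

/-- The monomial with exponent `k` at `2 ^ n` and `ε i` at `2 ^ n + 2 ^ i`. -/
noncomputable def binaryMonomial (n k : ℕ) (ε : ℕ → ℕ) : minimalGenerators (binaryFamily n) →₀ ℕ :=
  Finsupp.single (binaryBase n) k + ∑ i ∈ Finset.range n, ε i • binaryFactor n i

theorem binaryMonomial_add (n k k' : ℕ) (ε ε' : ℕ → ℕ) :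
    binaryMonomial n (k + k') (ε + ε') = binaryMonomial n k ε + binaryMonomial n k' ε' := by
  simp only [binaryMonomial, Pi.add_apply, add_smul, Finset.sum_add_distrib, Finsupp.single_add]
  exact add_add_add_comm _ _ _ _

theorem binaryMonomial_single {n i : ℕ} (hi : i < n) (k c : ℕ) :
    binaryMonomial n k (Pi.single i c) = Finsupp.single (binaryBase n) k + c • binaryFactor n i := by
  rw [binaryMonomial, Finset.sum_eq_single i]
  · simp
  · intro j _ hj
    simp [hj]
  · simp [hi]

theorem binaryMonomial_zero (n k : ℕ) :
    binaryMonomial n k 0 = Finsupp.single (binaryBase n) k := by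
  simp [binaryMonomial]

theorem exists_eq_binaryMonomial {n : ℕ} (a : minimalGenerators (binaryFamily n) →₀ ℕ) :
    ∃ k ε, a = binaryMonomial n k ε := by
  induction a using Finsupp.induction_linear with
  | zero => exact ⟨0, 0, by simp [binaryMonomial_zero]⟩
  | add a b ha hb =>
    obtain ⟨k, ε, rfl⟩ := ha
    obtain ⟨k', ε', rfl⟩ := hb
    exact ⟨_, _, (binaryMonomial_add n k k' ε ε').symm⟩
  | single r c =>
    have hr := (minimalGenerators_binaryFamily n).subset r.2
    rcases hr with hr | ⟨i, hi, hr⟩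
    · have : r = binaryBase n := Subtype.ext hr
      exact ⟨c, 0, by rw [binaryMonomial_zero, this]⟩
    · have : r = binaryGen hi := Subtype.ext hr
      refine ⟨0, Pi.single i c, ?_⟩
      rw [binaryMonomial_single hi, binaryFactor_of_lt hi, this]
      simp

theorem factorizationHom_binaryMonomial (n k : ℕ) (ε : ℕ → ℕ) :
    factorizationHom _ (binaryMonomial n k ε) =
      ∑ i ∈ Finset.range n, ε i * 2 ^ i + 2 ^ n * (k + ∑ i ∈ Finset.range n, ε i) := by
  have h : ∀ i ∈ Finset.range n, factorizationHom _ (ε i • binaryFactor n i) =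
      ε i * 2 ^ i + 2 ^ n * ε i := by
    intro i hi
    rw [map_nsmul, factorizationHom_binaryFactor (Finset.mem_range.1 hi).le, smul_eq_mul]
    ring
  rw [binaryMonomial, map_add, map_sum, Finset.sum_congr rfl h, factorizationHom_single,
    Finset.sum_add_distrib, ← Finset.mul_sum]
  change k * 2 ^ n + _ = _
  ring

/-- Uniqueness of the binary expansion with an unbounded top digit; the induction peels off the
parity bit. -/
theorem eq_of_sum_mul_two_pow_add_eq {n K K' : ℕ} {ε ε' : ℕ → ℕ} (hε : ∀ i < n, ε i ≤ 1)
    (hε' : ∀ i < n, ε' i ≤ 1)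
    (h : ∑ i ∈ Finset.range n, ε i * 2 ^ i + 2 ^ n * K =
      ∑ i ∈ Finset.range n, ε' i * 2 ^ i + 2 ^ n * K') :
    K = K' ∧ ∀ i < n, ε i = ε' i := by
  induction n generalizing ε ε' with
  | zero => simpa using h
  | succ n ih =>
    have hs : ∀ η : ℕ → ℕ, ∑ i ∈ Finset.range (n + 1), η i * 2 ^ i =
        2 * ∑ i ∈ Finset.range n, η (i + 1) * 2 ^ i + η 0 := by
      intro η
      rw [Finset.sum_range_succ', Finset.mul_sum, pow_zero, mul_one]
      congr 1
      exact Finset.sum_congr rfl fun i _ => by ring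
    have hp : ∀ L, 2 ^ (n + 1) * L = 2 * (2 ^ n * L) := fun L => by ring
    rw [hs, hs, hp, hp] at h
    have h0 := hε 0 n.succ_pos
    have h0' := hε' 0 n.succ_pos
    obtain ⟨hK, hi⟩ := ih (ε := fun i => ε (i + 1)) (ε' := fun i => ε' (i + 1))
      (fun i hi => hε _ (by omega)) (fun i hi => hε' _ (by omega)) (by omega)
    refine ⟨hK, fun i hin => ?_⟩
    rcases i with _ | i
    · omega
    · exact hi i (by omega)

/-- Every monomial is congruent to one with exponents at most `1` away from `2 ^ n`. -/
theorem exists_reduced_binaryMonomial {n : ℕ}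
    {c : AddCon (minimalGenerators (binaryFamily n) →₀ ℕ)}
    (hc : ∀ i < n, c (binaryRelation n i).1 (binaryRelation n i).2) (k : ℕ) (ε : ℕ → ℕ) :
    ∃ k' ε', (∀ i < n, ε' i ≤ 1) ∧ c (binaryMonomial n k ε) (binaryMonomial n k' ε') := by
  induction hm : ∑ i ∈ Finset.range n, ε i using Nat.strong_induction_on generalizing k ε with
  | _ m ih =>
    by_cases hred : ∀ i < n, ε i ≤ 1
    · exact ⟨k, ε, hred, c.refl _⟩
    push Not at hred
    obtain ⟨i, hi, h2⟩ := hred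
    obtain ⟨η, rfl⟩ : ∃ η : ℕ → ℕ, ε = η + Pi.single i 2 := by
      refine ⟨fun j => if j = i then ε i - 2 else ε j, ?_⟩
      ext j
      by_cases hj : j = i
      · subst hj
        simp
        omega
      · simp [hj]
    have hsum : ∀ j < n, ∀ e, ∑ l ∈ Finset.range n, (Pi.single j e : ℕ → ℕ) l = e := by
      intro j hj e
      rw [Finset.sum_pi_single', if_pos (Finset.mem_range.2 hj)]
    simp only [Pi.add_apply, Finset.sum_add_distrib, hsum i hi] at hm
    have hstep : c (binaryMonomial n k (η + Pi.single i 2))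
        (binaryMonomial n k η + (binaryFactor n (i + 1) + Finsupp.single (binaryBase n) 1)) := by
      have := binaryMonomial_add n k 0 η (Pi.single i 2)
      rw [binaryMonomial_single hi, Finsupp.single_zero, zero_add, add_zero] at this
      rw [this]
      exact c.add (c.refl _) (hc i hi)
    -- The exponent sum away from `2^n` drops: two copies of generator `i` become one copy of
    -- generator `i + 1` and one of `2^n`, or, when `i + 1 = n`, three copies of `2^n`.
    rcases (Nat.succ_le_iff.2 hi).lt_or_eq with hi' | hi'
    · have heq : binaryMonomial n k η +
          (binaryFactor n (i + 1) + Finsupp.single (binaryBase n) 1) =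
          binaryMonomial n (k + 1) (η + Pi.single (i + 1) 1) := by
        rw [binaryMonomial_add, binaryMonomial_single hi', one_smul, add_comm (binaryFactor n _)]
      rw [heq] at hstep
      obtain ⟨k', ε', h, h'⟩ := ih (m - 1) (by omega) (k + 1) (η + Pi.single (i + 1) 1) (by
        simp only [Pi.add_apply, Finset.sum_add_distrib, hsum _ hi']
        omega)
      exact ⟨k', ε', h, c.trans hstep h'⟩
    · have heq : binaryMonomial n k η +
          (binaryFactor n (i + 1) + Finsupp.single (binaryBase n) 1) =
          binaryMonomial n (k + 3) η := by
        have := binaryMonomial_add n k 3 η 0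
        rw [binaryMonomial_zero, add_zero] at this
        rw [this, show i + 1 = n from hi', binaryFactor_self, ← Finsupp.single_add]
      rw [heq] at hstep
      obtain ⟨k', ε', h, h'⟩ := ih (m - 2) (by omega) (k + 3) η (by omega)
      exact ⟨k', ε', h, c.trans hstep h'⟩

theorem factorizationHom_binaryRelation {n i : ℕ} (hi : i < n) :
    factorizationHom _ (binaryRelation n i).1 = factorizationHom _ (binaryRelation n i).2 := by
  simp only [binaryRelation, map_nsmul, map_add, factorizationHom_binaryFactor hi.le,
    factorizationHom_binaryFactor (Nat.succ_le_iff.2 hi), factorizationHom_single, smul_eq_mul]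
  change _ = _ + 1 * 2 ^ n
  rw [Nat.succ_eq_add_one]
  ring

theorem isPresentation_binaryRelations (n : ℕ) :
    IsPresentation (binaryFamily n) (binaryRelations n) := by
  have hle : addConGen (fun a b => (a, b) ∈ binaryRelations n) ≤
      AddCon.ker (factorizationHom (binaryFamily n)) := by
    refine AddCon.addConGen_le.2 fun a b hab => ?_
    obtain ⟨i, hi, h⟩ := hab
    have := factorizationHom_binaryRelation (Finset.mem_range.1 hi)
    rwa [h] at this
  refine le_antisymm hle fun a b hab => ?_
  have hab : factorizationHom _ a = factorizationHom _ b := hab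
  set c := addConGen (fun a b => (a, b) ∈ binaryRelations n)
  have hc : ∀ i < n, c (binaryRelation n i).1 (binaryRelation n i).2 := fun i hi =>
    AddConGen.Rel.of _ _ ⟨i, Finset.mem_coe.2 (Finset.mem_range.2 hi), rfl⟩
  obtain ⟨k, ε, rfl⟩ := exists_eq_binaryMonomial a
  obtain ⟨l, η, rfl⟩ := exists_eq_binaryMonomial b
  obtain ⟨k', ε', hε, hk⟩ := exists_reduced_binaryMonomial hc k ε
  obtain ⟨l', η', hη, hl⟩ := exists_reduced_binaryMonomial hc l η
  have h1 : factorizationHom _ _ = factorizationHom _ _ := hle hk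
  have h2 : factorizationHom _ _ = factorizationHom _ _ := hle hl
  have h := (h1.symm.trans hab).trans h2
  rw [factorizationHom_binaryMonomial, factorizationHom_binaryMonomial] at h
  obtain ⟨hK, he⟩ := eq_of_sum_mul_two_pow_add_eq hε hη h
  have hs : ∑ i ∈ Finset.range n, ε' i = ∑ i ∈ Finset.range n, η' i :=
    Finset.sum_congr rfl fun i hi => he i (Finset.mem_range.1 hi)
  -- The top digit is `k' + ∑ ε'`, so agreement of the other digits fixes the exponent of `2^n` as
  -- well.
  have hkl : k' = l' := by omega
  have hmon : binaryMonomial n k' ε' = binaryMonomial n l' η' := by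
    rw [binaryMonomial, binaryMonomial, hkl]
    congr 1
    exact Finset.sum_congr rfl fun i hi => by rw [he i (Finset.mem_range.1 hi)]
  rw [hmon] at hk
  exact c.trans hk (c.symm hl)

/-- The congruence collapsing the ideal of all elements that do not divide `u`. -/
def reesCon {M : Type*} [AddCommMonoid M] [PartialOrder M] [CanonicallyOrderedAdd M] (u : M) :
    AddCon M where
  r a b := a = b ∨ (¬ a ≤ u ∧ ¬ b ≤ u)
  iseqv := ⟨fun _ => Or.inl rfl, fun h => h.imp Eq.symm And.symm, by
    rintro a b c (rfl | h) (rfl | h')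
    · exact Or.inl rfl
    · exact Or.inr h'
    · exact Or.inr h
    · exact Or.inr ⟨h.1, h'.2⟩⟩
  add' := by
    rintro a b c d (rfl | h) (rfl | h')
    · exact Or.inl rfl
    · exact Or.inr ⟨fun h => h'.1 (le_add_self.trans h), fun h => h'.2 (le_add_self.trans h)⟩
    · exact Or.inr ⟨fun h' => h.1 (le_self_add.trans h'), fun h' => h.2 (le_self_add.trans h')⟩
    · exact Or.inr ⟨fun h' => h.1 (le_self_add.trans h'), fun h' => h.2 (le_self_add.trans h')⟩

/-- Let `u` be the left side of relation `i`. No right side divides `u`, nor does the left side of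
any other relation, so `reesCon u` contains all the other relations. Since `u` is alone in its class
there, relation `i` cannot follow from them. -/
theorem isMinimalPresentation_binaryRelations (n : ℕ) :
    IsMinimalPresentation (binaryFamily n) (binaryRelations n) := by
  refine ⟨isPresentation_binaryRelations n, fun ρ hρ hsub => ?_⟩
  rintro _ ⟨i, hi, rfl⟩
  replace hi := Finset.mem_range.1 hi
  by_contra hnot
  -- Every right side involves the generator `2^n`, which `u` does not.
  have hsnd : ∀ j, ¬ (binaryRelation n j).2 ≤ (binaryRelation n i).1 := by
    intro j h
    have := h (binaryBase n)
    simp [binaryRelation, binaryFactor_of_lt hi, binaryGen_ne_binaryBase hi] at this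
  have hle : addConGen (fun a b => (a, b) ∈ ρ) ≤ reesCon (binaryRelation n i).1 := by
    refine AddCon.addConGen_le.2 fun a b hab => ?_
    obtain ⟨j, hj, h⟩ := hsub hab
    replace hj := Finset.mem_range.1 hj
    have hji : j ≠ i := by
      rintro rfl
      exact hnot (h ▸ hab)
    obtain ⟨rfl, rfl⟩ := Prod.ext_iff.1 h
    refine Or.inr ⟨fun h => ?_, hsnd j⟩
    have := h (binaryGen hj)
    simp [binaryRelation, binaryFactor_of_lt hi, binaryFactor_of_lt hj,
      binaryGen_inj, hji.symm] at this
  rw [hρ] at hle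
  have h : reesCon (binaryRelation n i).1 (binaryRelation n i).1 (binaryRelation n i).2 :=
    hle (factorizationHom_binaryRelation hi)
  rcases h with h | h
  · exact hsnd i h.symm.le
  · exact h.1 le_rfl

theorem isCompleteIntersection_binaryFamily (n : ℕ) :
    IsCompleteIntersection (binaryFamily n) := by
  refine ⟨binaryRelations n, isMinimalPresentation_binaryRelations n, ?_⟩
  have hinj : Set.InjOn (binaryRelation n) (Finset.range n : Set ℕ) := by
    intro i hi j hj h
    replace hi := Finset.mem_range.1 hi
    replace hj := Finset.mem_range.1 hj
    have h1 := DFunLike.congr_fun (congrArg Prod.fst h) (binaryGen hi)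
    by_contra hij
    simp [binaryRelation, binaryFactor_of_lt hi, binaryFactor_of_lt hj,
      binaryGen_inj, Ne.symm hij] at h1
  rw [binaryRelations, hinj.encard_image, Set.encard_coe_eq_coe_finsetCard, Finset.card_range,
    embeddingDimension_binaryFamily]
  rfl

theorem proposition2p4 :
    (∀ Γ : AddSubmonoid ℕ, IsNumericalSemigroup Γ → IsCompleteIntersection Γ →
      2 ^ (embeddingDimension Γ - 1) ≤ multiplicityOf Γ) ∧
    (binaryFamily 1 = AddSubmonoid.closure {2, 3} ∧
      binaryFamily 2 = AddSubmonoid.closure {4, 5, 6} ∧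
      binaryFamily 3 = AddSubmonoid.closure {8, 9, 10, 12} ∧
      ∀ n : ℕ, 1 ≤ n →
        binaryFamily (n + 1) =
          (binaryFamily n).map (AddMonoidHom.mulLeft 2) ⊔
            AddSubmonoid.multiples (2 ^ (n + 1) + 1) ∧
        IsNumericalSemigroup (binaryFamily n) ∧
        IsCompleteIntersection (binaryFamily n) ∧
        multiplicityOf (binaryFamily n) = 2 ^ n ∧
        embeddingDimension (binaryFamily n) = n + 1) := by
  refine ⟨fun Γ hΓ hCI => hCI.two_pow_le_multiplicityOf hΓ, ?_, ?_, ?_, fun n hn =>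
    ⟨binaryFamily_succ n, isNumericalSemigroup_binaryFamily hn,
      isCompleteIntersection_binaryFamily n, multiplicityOf_binaryFamily n,
      embeddingDimension_binaryFamily n⟩⟩
  all_goals
    rw [binaryFamily]
    congr 1
    ext x
    simp only [Set.mem_union, Set.mem_singleton_iff, Set.mem_ofPred_eq, Set.mem_insert_iff,
      Nat.exists_lt_succ_right, Nat.not_lt_zero, false_and, exists_false, false_or]
    norm_num [or_assoc]
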